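/- Conventions. Manifolds are smooth ($C^\infty$), finite-dimensional, without boundary, Hausdorff and second countable. A Lie groupoid $G=(G_1\rightrightarrows G_0)$ has source $s$ and target $t$, which are submersions. It is étale if $s$ and $t$ are local diffeomorphisms, and proper if $(s,t):G_1\to G_0\times G_0$ is a proper map. An étale Lie groupoid is effective if any two arrows $g,g'$ with the same source $x$ and the same target, for which the germs at $x$ of $\phi_g=t|_U\circ(s|_U)^{-1}$ ($U$ a small neighbourhood of $g$) and of $\phi_{g'}$ coincide, are equal. The orbit space $G_0/G_1$ is the quotient of $G_0$ by the relation $x\sim y$ if there is $g\in G_1$ with $s(g)=x$ and $t(g)=y$; $\pi_G:G_0\to G_0/G_1$ is the quotient map. It carries the quotient differential structure $C^\infty(G_0/G_1)=\{f:G_0/G_1\to\mathbb{R}\mid f\circ\pi_G\in C^\infty(G_0)\}$. A map $F:X\to Y$ between sets with differential structures is smooth if $f\circ F\in C^\infty(X)$ for all $f\in C^\infty(Y)$, and a diffeomorphism if it is bijective and both $F$ and $F^{-1}$ are smooth. A bibundle $P:G\to H$ between Lie groupoids is a manifold $P$ with a smooth left action of $G$ with anchor $a_L:P\to G_0$ and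 a smooth right action of $H$ with anchor $a_R:P\to H_0$ such that the two actions commute, $a_R$ is $G$-invariant, and $a_L$ is a principal right $H$-bundle; the latter means that $a_L$ is an $H$-invariant surjective submersion and that $P\times_{H_0}H_1\to P\times_{G_0}P$, $(p,h)\mapsto(p,p\cdot h)$, is a diffeomorphism. The bibundle $P$ is a Morita equivalence (invertible) if in addition $a_R:P\to H_0$ is a principal left $G$-bundle, defined in the same way. An isomorphism of bibundles $P\to Q$ is a diffeomorphism that preserves both anchors and is equivariant for both actions. Statement. Let $G=(G_1\rightrightarrows G_0)$ and $H=(H_1\rightrightarrows H_0)$ be effective proper étale Lie groupoids and let $P:G\to H$ be a bibundle. Then there is a unique map $\bar P:G_0/G_1\to H_0/H_1$ with $$\bar P\circ\pi_G\circ a_L=\pi_H\circ a_R ,$$ and $\bar P$ is smooth for the quotient differential structures. If $P$ is a Morita equivalence, then $\bar P$ is a diffeomorphism. If $Q:G\to H$ is another bibundle that is isomorphic to $P$, then $\bar Q=\bar P$. -/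

import Mathlib

open scoped Manifold ContDiff Topology

universe u v u' v' w w' x

namespace OrbitMap

/-! ### Differential spaces -/

/-- The weakest topology on `X` for which every member of `F` is continuous. -/
abbrev functionalTopology {X : Type*} (F : Set (X → ℝ)) : TopologicalSpace X :=
  ⨅ f ∈ F, TopologicalSpace.induced f inferInstance

/-- A (Sikorski) differential structure on a set `X`. -/
structure DifferentialStructure (X : Type*) where
  /-- The family of functions. -/
  functions : Set (X → ℝ)
  smooth_compat : ∀ (k : ℕ), 0 < k → ∀ f : Fin k → X → ℝ, (∀ i, f i ∈ functions) →
    ∀ g : EuclideanSpace ℝ (Fin k) → ℝ, ContDiff ℝ ∞ g →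
      (fun x => g (WithLp.toLp 2 fun i => f i x)) ∈ functions
  locality : ∀ f : X → ℝ,
    (∀ x, ∃ U : Set X, IsOpen[functionalTopology functions] U ∧ x ∈ U ∧
      ∃ g ∈ functions, Set.EqOn f g U) → f ∈ functions

/-- Functionally smooth maps: pullback takes the functions of `Y` to functions of `X`. -/
def IsSmoothMap {X Y : Type*} (FX : DifferentialStructure X) (FY : DifferentialStructure Y)
    (φ : X → Y) : Prop :=
  ∀ f ∈ FY.functions, f ∘ φ ∈ FX.functions

/-- Functional diffeomorphisms: smooth bijections whose inverse is smooth. -/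
def IsDiffeomorphism {X Y : Type*} (FX : DifferentialStructure X)
    (FY : DifferentialStructure Y) (φ : X → Y) : Prop :=
  ∃ e : X ≃ Y, ⇑e = φ ∧ IsSmoothMap FX FY e ∧ IsSmoothMap FY FX e.symm

/-- The quotient differential structure: the functions whose pullback along the quotient map
belongs to the given structure. -/
def DifferentialStructure.quotient {X : Type*} (F : DifferentialStructure X) (r : Setoid X) :
    DifferentialStructure (Quotient r) where
  functions := {f | f ∘ Quotient.mk r ∈ F.functions}
  smooth_compat k hk f hf g hg := F.smooth_compat k hk (fun i => f i ∘ Quotient.mk r) hf g hg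
  locality f hf := by
    refine F.locality _ fun x => ?_
    obtain ⟨U, hU, hxU, g, hg, hfg⟩ := hf (Quotient.mk r x)
    refine ⟨Quotient.mk r ⁻¹' U, ?_, hxU, g ∘ Quotient.mk r, hg, fun y hy => hfg hy⟩
    have hc : @Continuous _ _ (functionalTopology F.functions)
        (functionalTopology {f | f ∘ Quotient.mk r ∈ F.functions}) (Quotient.mk r) := by
      refine continuous_iInf_rng.2 fun f => continuous_iInf_rng.2 fun hf => ?_
      refine continuous_induced_rng.2 ?_
      exact continuous_iInf_dom (i := f ∘ Quotient.mk r)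
        (continuous_iInf_dom (i := hf) continuous_induced_dom)
    exact continuous_def.1 hc U hU

/-! ### Manifolds -/

/-- Smooth manifolds: Hausdorff, second countable, without boundary, of some dimension `dim`. -/
structure SmoothMfd where
  carrier : Type u
  dim : ℕ
  [top : TopologicalSpace carrier]
  [charted : ChartedSpace (EuclideanSpace ℝ (Fin dim)) carrier]
  [manifold : IsManifold (𝓡 dim) ∞ carrier]
  [t2 : T2Space carrier]
  [secondCountable : SecondCountableTopology carrier]

instance : CoeSort SmoothMfd.{u} (Type u) := ⟨SmoothMfd.carrier⟩

attribute [instance] SmoothMfd.top SmoothMfd.charted SmoothMfd.manifold SmoothMfd.t2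
  SmoothMfd.secondCountable

/-- The model with corners of a manifold. -/
noncomputable abbrev SmoothMfd.model (M : SmoothMfd.{u}) :
    ModelWithCorners ℝ (EuclideanSpace ℝ (Fin M.dim)) (EuclideanSpace ℝ (Fin M.dim)) :=
  𝓡 M.dim

/-- The differential structure of a manifold: its smooth real-valued functions. -/
def SmoothMfd.smoothFunctions (M : SmoothMfd.{u}) : DifferentialStructure M where
  functions := {f | ContMDiff M.model 𝓘(ℝ, ℝ) ∞ f}
  smooth_compat k _ f hf g hg := by
    refine hg.contMDiff.comp (I' := 𝓘(ℝ, EuclideanSpace ℝ (Fin k))) ?_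
    have h : ContMDiff M.model 𝓘(ℝ, Fin k → ℝ) ∞ fun x i => f i x :=
      contMDiff_pi_space.2 hf
    exact ((EuclideanSpace.equiv (Fin k) ℝ).symm.contDiff.contMDiff).comp h
  locality f hf := by
    intro x
    obtain ⟨U, hU, hxU, g, hg, hfg⟩ := hf x
    have hle : M.top ≤ functionalTopology {f : M → ℝ | ContMDiff M.model 𝓘(ℝ, ℝ) ∞ f} :=
      le_iInf fun f => le_iInf fun hf => continuous_iff_le_induced.1 hf.continuous
    exact (hg x).congr_of_eventuallyEq
      (Filter.eventuallyEq_of_mem ((hle U hU).mem_nhds hxU) hfg)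

/-- `f` restricts to a diffeomorphism from `S ⊆ M` onto `T ⊆ N`. It is used where `S` and `T` are
embedded submanifolds (fibre products along submersions); there smoothness on the set is
smoothness for the submanifold structure. -/
def IsDiffeoBetween {E E' H H' M N : Type*}
    [NormedAddCommGroup E] [NormedSpace ℝ E] [NormedAddCommGroup E'] [NormedSpace ℝ E']
    [TopologicalSpace H] [TopologicalSpace H'] (I : ModelWithCorners ℝ E H)
    (J : ModelWithCorners ℝ E' H') [TopologicalSpace M] [ChartedSpace H M]
    [TopologicalSpace N] [ChartedSpace H' N] (f : M → N) (S : Set M) (T : Set N) : Prop :=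
  ContMDiffOn I J ∞ f S ∧ Set.MapsTo f S T ∧
    ∃ g : N → M, ContMDiffOn J I ∞ g T ∧ Set.MapsTo g T S ∧ Set.InvOn g f S T

/-! ### Lie groupoids -/

/-- Lie groupoids. The product `mul g h` ("first `h`, then `g`") is meaningful only if
`src g = tgt h`; every condition on it, smoothness included, is restricted to such pairs, and its
other values are irrelevant. -/
structure LieGroupoid where
  Obj : SmoothMfd.{u}
  Arr : SmoothMfd.{v}
  src : Arr → Obj
  tgt : Arr → Obj
  unit : Obj → Arr
  inv : Arr → Arr
  mul : Arr → Arr → Arr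
  submersion_src : Manifold.IsSubmersion Arr.model Obj.model ∞ src
  submersion_tgt : Manifold.IsSubmersion Arr.model Obj.model ∞ tgt
  smooth_unit : ContMDiff Obj.model Arr.model ∞ unit
  smooth_inv : ContMDiff Arr.model Arr.model ∞ inv
  smooth_mul : ContMDiffOn (Arr.model.prod Arr.model) Arr.model ∞
    (fun q : Arr × Arr => mul q.1 q.2) {q | src q.1 = tgt q.2}
  src_unit : ∀ x, src (unit x) = x
  tgt_unit : ∀ x, tgt (unit x) = x
  src_inv : ∀ g, src (inv g) = tgt g
  tgt_inv : ∀ g, tgt (inv g) = src g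
  src_mul : ∀ g h, src g = tgt h → src (mul g h) = src h
  tgt_mul : ∀ g h, src g = tgt h → tgt (mul g h) = tgt g
  mul_assoc : ∀ g h k, src g = tgt h → src h = tgt k → mul (mul g h) k = mul g (mul h k)
  unit_mul : ∀ g, mul (unit (tgt g)) g = g
  mul_unit : ∀ g, mul g (unit (src g)) = g
  inv_mul : ∀ g, mul (inv g) g = unit (src g)
  mul_inv : ∀ g, mul g (inv g) = unit (tgt g)

namespace LieGroupoid

/-- Étale: source and target are local diffeomorphisms. -/
structure IsEtale (G : LieGroupoid.{u, v}) : Prop where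
  src : IsLocalDiffeomorph G.Arr.model G.Obj.model ∞ G.src
  tgt : IsLocalDiffeomorph G.Arr.model G.Obj.model ∞ G.tgt

/-- The local diffeomorphism `φ_g = t ∘ (s|_U)⁻¹` for a small neighbourhood `U` of `g`. Only its
germ at `src g` is meaningful (and independent of `U`). -/
noncomputable def IsEtale.localMap {G : LieGroupoid.{u, v}} (hG : G.IsEtale) (g : G.Arr) :
    G.Obj → G.Obj :=
  fun x => G.tgt ((hG.src g).localInverse x)

/-- Effective: the functor to the groupoid of germs, sending `g` to the germ of `φ_g` at `src g`,
is faithful. -/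
def IsEtale.IsEffective {G : LieGroupoid.{u, v}} (hG : G.IsEtale) : Prop :=
  ∀ g g' : G.Arr, G.src g = G.src g' → G.tgt g = G.tgt g' →
    hG.localMap g =ᶠ[𝓝 (G.src g)] hG.localMap g' → g = g'

/-- Proper: the map `(s, t)` is proper. -/
def IsProper (G : LieGroupoid.{u, v}) : Prop :=
  IsProperMap fun g : G.Arr => (G.src g, G.tgt g)

/-- Effective proper étale Lie groupoids. -/
structure IsEffectiveProperEtale (G : LieGroupoid.{u, v}) : Prop where
  etale : G.IsEtale
  effective : etale.IsEffective
  proper : G.IsProper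

/-- Two objects are equivalent if there is an arrow from one to the other. -/
def orbitRel (G : LieGroupoid.{u, v}) : Setoid G.Obj where
  r x y := ∃ g : G.Arr, G.src g = x ∧ G.tgt g = y
  iseqv :=
    { refl := fun x => ⟨G.unit x, G.src_unit x, G.tgt_unit x⟩
      symm := by
        rintro x y ⟨g, rfl, rfl⟩
        exact ⟨G.inv g, G.src_inv g, G.tgt_inv g⟩
      trans := by
        rintro x y z ⟨g, rfl, rfl⟩ ⟨h, hh, rfl⟩
        exact ⟨G.mul h g, G.src_mul h g hh, G.tgt_mul h g hh⟩ }

/-- The orbit space `G₀ / G₁`. -/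
def OrbitSpace (G : LieGroupoid.{u, v}) : Type u := Quotient G.orbitRel

/-- The quotient map `π_G : G₀ → G₀ / G₁`. -/
def proj (G : LieGroupoid.{u, v}) (x : G.Obj) : G.OrbitSpace := Quotient.mk G.orbitRel x

/-- The quotient differential structure on the orbit space. -/
def orbitStructure (G : LieGroupoid.{u, v}) : DifferentialStructure G.OrbitSpace :=
  G.Obj.smoothFunctions.quotient G.orbitRel

end LieGroupoid

/-! ### Actions and bibundles -/

/-- Smooth left actions of a Lie groupoid. Here `act g p` is meaningful only if
`src g = anchor p`. -/
structure LeftAction (G : LieGroupoid.{u, v}) (P : SmoothMfd.{w}) where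
  anchor : P → G.Obj
  act : G.Arr → P → P
  smooth_anchor : ContMDiff P.model G.Obj.model ∞ anchor
  smooth_act : ContMDiffOn (G.Arr.model.prod P.model) P.model ∞
    (fun q : G.Arr × P => act q.1 q.2) {q | G.src q.1 = anchor q.2}
  anchor_act : ∀ g p, G.src g = anchor p → anchor (act g p) = G.tgt g
  unit_act : ∀ p, act (G.unit (anchor p)) p = p
  mul_act : ∀ g h p, G.src g = G.tgt h → G.src h = anchor p →
    act (G.mul g h) p = act g (act h p)

/-- Smooth right actions of a Lie groupoid. Here `act p h` is meaningful only if
`anchor p = tgt h`. -/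
structure RightAction (H : LieGroupoid.{u', v'}) (P : SmoothMfd.{w}) where
  anchor : P → H.Obj
  act : P → H.Arr → P
  smooth_anchor : ContMDiff P.model H.Obj.model ∞ anchor
  smooth_act : ContMDiffOn (P.model.prod H.Arr.model) P.model ∞
    (fun q : P × H.Arr => act q.1 q.2) {q | anchor q.1 = H.tgt q.2}
  anchor_act : ∀ p h, anchor p = H.tgt h → anchor (act p h) = H.src h
  act_unit : ∀ p, act p (H.unit (anchor p)) = p
  act_mul : ∀ p h k, anchor p = H.tgt h → H.src h = H.tgt k →
    act p (H.mul h k) = act (act p h) k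

/-- `π : P → B` is a principal right `H`-bundle: an `H`-invariant surjective submersion for which
`P ×_{H₀} H₁ → P ×_B P`, `(p, h) ↦ (p, p · h)`, is a diffeomorphism. -/
structure RightAction.IsPrincipal {H : LieGroupoid.{u', v'}} {P : SmoothMfd.{w}} (A : RightAction H P)
    {B : SmoothMfd.{x}} (π : P → B) : Prop where
  surjective : Function.Surjective π
  submersion : Manifold.IsSubmersion P.model B.model ∞ π
  invariant : ∀ p h, A.anchor p = H.tgt h → π (A.act p h) = π p
  diffeo : IsDiffeoBetween (P.model.prod H.Arr.model) (P.model.prod P.model)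
    (fun q : P × H.Arr => (q.1, A.act q.1 q.2))
    {q | A.anchor q.1 = H.tgt q.2} {q : P × P | π q.1 = π q.2}

/-- `π : P → B` is a principal left `G`-bundle: a `G`-invariant surjective submersion for which
`G₁ ×_{G₀} P → P ×_B P`, `(g, p) ↦ (g · p, p)`, is a diffeomorphism. -/
structure LeftAction.IsPrincipal {G : LieGroupoid.{u, v}} {P : SmoothMfd.{w}} (A : LeftAction G P)
    {B : SmoothMfd.{x}} (π : P → B) : Prop where
  surjective : Function.Surjective π
  submersion : Manifold.IsSubmersion P.model B.model ∞ π
  invariant : ∀ g p, G.src g = A.anchor p → π (A.act g p) = π p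
  diffeo : IsDiffeoBetween (G.Arr.model.prod P.model) (P.model.prod P.model)
    (fun q : G.Arr × P => (A.act q.1 q.2, q.2))
    {q | G.src q.1 = A.anchor q.2} {q : P × P | π q.1 = π q.2}

/-- Bibundles `P : G → H`. -/
structure Bibundle (G : LieGroupoid.{u, v}) (H : LieGroupoid.{u', v'}) where
  total : SmoothMfd.{w}
  left : LeftAction G total
  right : RightAction H total
  actions_commute : ∀ g p h, G.src g = left.anchor p → right.anchor p = H.tgt h →
    right.act (left.act g p) h = left.act g (right.act p h)
  principal : right.IsPrincipal left.anchor
  invariant : ∀ g p, G.src g = left.anchor p → right.anchor (left.act g p) = right.anchor p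

namespace Bibundle

/-- A bibundle is invertible (a Morita equivalence) if its right anchor is a principal left
`G`-bundle. -/
def IsInvertible {G : LieGroupoid.{u, v}} {H : LieGroupoid.{u', v'}} (P : Bibundle.{u, v, u', v', w} G H) : Prop :=
  P.left.IsPrincipal P.right.anchor

/-- Isomorphisms of bibundles: equivariant diffeomorphisms. That both anchors are preserved is
part of equivariance, as it makes the actions on `α p` defined exactly when those on `p` are. -/
structure Iso {G : LieGroupoid.{u, v}} {H : LieGroupoid.{u', v'}} 
    (P : Bibundle.{u, v, u', v', w} G H) (Q : Bibundle.{u, v, u', v', w'} G H) where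
  toDiffeo : Diffeomorph P.total.model Q.total.model P.total Q.total ∞
  left_anchor : ∀ p, Q.left.anchor (toDiffeo p) = P.left.anchor p
  right_anchor : ∀ p, Q.right.anchor (toDiffeo p) = P.right.anchor p
  map_left : ∀ g p, G.src g = P.left.anchor p →
    toDiffeo (P.left.act g p) = Q.left.act g (toDiffeo p)
  map_right : ∀ p h, P.right.anchor p = H.tgt h →
    toDiffeo (P.right.act p h) = Q.right.act (toDiffeo p) h

/-- `φ` makes the diagram with the anchors and the quotient maps commute:
`φ ∘ π_G ∘ a_L = π_H ∘ a_R`. -/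
def DescendsTo {G : LieGroupoid.{u, v}} {H : LieGroupoid.{u', v'}} (P : Bibundle.{u, v, u', v', w} G H) (φ : G.OrbitSpace → H.OrbitSpace) : Prop :=
  ∀ p : P.total, φ (G.proj (P.left.anchor p)) = H.proj (P.right.anchor p)

end Bibundle

end OrbitMap

/-!
Submersions admit smooth local sections, so a function on the base of a surjective submersion is
smooth as soon as its pullback to the total space is. The left anchor of a bibundle is a surjective
submersion, which makes every map of orbit spaces that lifts to the bibundle smooth.

Two points of the bibundle with the same left anchor differ by an arrow of `H`, and `G` preserves
the right anchor; hence `p ↦ π_H (a_R p)` is constant on the fibres of `p ↦ π_G (a_L p)`, and the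
bibundle does induce a map of orbit spaces. For a Morita equivalence the roles of the anchors can
be exchanged: the induced map is then bijective, and its inverse is smooth for the same reason.
-/

namespace OrbitMap

section Submersion

open Manifold

variable {𝕜 E E' E'' H H' H'' M N Q : Type*} [NontriviallyNormedField 𝕜]
  [NormedAddCommGroup E] [NormedSpace 𝕜 E] [NormedAddCommGroup E'] [NormedSpace 𝕜 E']
  [NormedAddCommGroup E''] [NormedSpace 𝕜 E'']
  [TopologicalSpace H] [TopologicalSpace H'] [TopologicalSpace H'']
  {I : ModelWithCorners 𝕜 E H} {J : ModelWithCorners 𝕜 E' H'} {K : ModelWithCorners 𝕜 E'' H''}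
  [TopologicalSpace M] [ChartedSpace H M] [TopologicalSpace N] [ChartedSpace H' N]
  [TopologicalSpace Q] [ChartedSpace H'' Q]
  {n : WithTop ℕ∞} {π : M → N} {f : N → Q} {p : M}

/-- The expression in the chart of the domain of a local section through `p` of a submersion `π`:
as `π` is `(u, v) ↦ u` in adapted charts, it is the slice `u ↦ (u, v)` with `v` the second
coordinate of `p`. It is meaningful near `π p` only. -/
noncomputable def chartedSection (hπ : IsSubmersionAt I J n π p) (y : N) : E :=
  hπ.equiv.symm (hπ.codChart.extend J y, (hπ.equiv (hπ.domChart.extend I p)).2)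

/-- A local section through `p` of a submersion `π`. It is meaningful near `π p` only. -/
noncomputable def localSection (hπ : IsSubmersionAt I J n π p) : N → M :=
  (hπ.domChart.extend I).symm ∘ chartedSection hπ

theorem codChart_extend_apply_domChart_extend_symm (hπ : IsSubmersionAt I J n π p) {v : E}
    (hv : v ∈ (hπ.domChart.extend I).target) :
    hπ.codChart.extend J (π ((hπ.domChart.extend I).symm v)) = (hπ.equiv v).1 :=
  hπ.writtenInCharts hv

theorem mem_domChart_extend_source (hπ : IsSubmersionAt I J n π p) :
    p ∈ (hπ.domChart.extend I).source := by
  simpa only [OpenPartialHomeomorph.extend_source] using hπ.mem_domChart_source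

theorem chartedSection_apply_self (hπ : IsSubmersionAt I J n π p) :
    chartedSection hπ (π p) = hπ.domChart.extend I p := by
  have hp := mem_domChart_extend_source hπ
  have hfst : hπ.codChart.extend J (π p) = (hπ.equiv (hπ.domChart.extend I p)).1 := by
    simpa only [(hπ.domChart.extend I).left_inv hp] using
      codChart_extend_apply_domChart_extend_symm hπ ((hπ.domChart.extend I).map_source hp)
  rw [chartedSection, hfst, Prod.mk.eta, hπ.equiv.symm_apply_apply]

theorem localSection_apply_self (hπ : IsSubmersionAt I J n π p) : localSection hπ (π p) = p := by
  rw [localSection, Function.comp_apply, chartedSection_apply_self,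
    (hπ.domChart.extend I).left_inv (mem_domChart_extend_source hπ)]

theorem contMDiffAt_chartedSection (hπ : IsSubmersionAt I J n π p) :
    ContMDiffAt J 𝓘(𝕜, E) n (chartedSection hπ) (π p) :=
  hπ.equiv.symm.contDiff.contMDiff.contMDiffAt.comp _
    ((OpenPartialHomeomorph.contMDiffAt_extend hπ.codChart_mem_maximalAtlas
      hπ.mem_codChart_source).prodMk_space contMDiffAt_const)

theorem apply_localSection (hπ : IsSubmersionAt I J n π p) {y : N}
    (hy : y ∈ hπ.codChart.source)
    (hy' : chartedSection hπ y ∈ (hπ.domChart.extend I).target) :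
    π (localSection hπ y) = y := by
  have hmem : localSection hπ y ∈ hπ.domChart.source := by
    simpa only [localSection, Function.comp_apply, OpenPartialHomeomorph.extend_source] using
      (hπ.domChart.extend I).map_target hy'
  refine (hπ.codChart.extend J).injOn ?_ ?_ ?_
  · rw [OpenPartialHomeomorph.extend_source]
    exact hπ.source_subset_preimage_source hmem
  · rwa [OpenPartialHomeomorph.extend_source]
  · calc hπ.codChart.extend J (π (localSection hπ y))
        = (hπ.equiv (chartedSection hπ y)).1 := codChart_extend_apply_domChart_extend_symm hπ hy'
      _ = hπ.codChart.extend J y := by rw [chartedSection, hπ.equiv.apply_symm_apply]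

variable [I.Boundaryless]

theorem domChart_extend_target_mem_nhds (hπ : IsSubmersionAt I J n π p) :
    (hπ.domChart.extend I).target ∈ 𝓝 (chartedSection hπ (π p)) := by
  rw [chartedSection_apply_self]
  exact hπ.domChart.isOpen_extend_target.mem_nhds
    ((hπ.domChart.extend I).map_source (mem_domChart_extend_source hπ))

theorem contMDiffAt_localSection (hπ : IsSubmersionAt I J n π p) :
    ContMDiffAt J I n (localSection hπ) (π p) := by
  refine ContMDiffAt.comp (I' := 𝓘(𝕜, E)) _ ?_ (contMDiffAt_chartedSection hπ)
  refine (contMDiffOn_extend_symm hπ.domChart_mem_maximalAtlas).contMDiffAt ?_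
  rw [← OpenPartialHomeomorph.extend_target']
  exact domChart_extend_target_mem_nhds hπ

theorem eventually_apply_localSection (hπ : IsSubmersionAt I J n π p) :
    ∀ᶠ y in 𝓝 (π p), π (localSection hπ y) = y := by
  filter_upwards [hπ.codChart.open_source.mem_nhds hπ.mem_codChart_source,
    (contMDiffAt_chartedSection hπ).continuousAt.eventually (domChart_extend_target_mem_nhds hπ)]
    with y hy hy'
  exact apply_localSection hπ hy hy'

theorem contMDiffAt_of_comp_submersion (hπ : IsSubmersionAt I J n π p)
    (hf : ContMDiffAt I K n (f ∘ π) p) : ContMDiffAt J K n f (π p) := by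
  have hcomp : ContMDiffAt J K n ((f ∘ π) ∘ localSection hπ) (π p) :=
    ContMDiffAt.comp (I' := I) _ (by rwa [localSection_apply_self]) (contMDiffAt_localSection hπ)
  refine hcomp.congr_of_eventuallyEq ?_
  filter_upwards [eventually_apply_localSection hπ] with y hy
  simp only [Function.comp_apply, hy]

theorem contMDiff_of_comp_submersion (hsurj : Function.Surjective π) (hπ : IsSubmersion I J n π)
    (hf : ContMDiff I K n (f ∘ π)) : ContMDiff J K n f := by
  intro x
  obtain ⟨p, rfl⟩ := hsurj x
  exact contMDiffAt_of_comp_submersion (hπ.isSubmersionAt p) (hf p)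

end Submersion

section DifferentialStructure

theorem isSmoothMap_of_contMDiff {M : SmoothMfd.{u}} {N : SmoothMfd.{v}} {φ : M → N}
    (hφ : ContMDiff M.model N.model ∞ φ) :
    IsSmoothMap M.smoothFunctions N.smoothFunctions φ :=
  fun _ hf => ContMDiff.comp (I' := N.model) hf hφ

theorem IsSmoothMap.quotientMk_comp {X Y : Type*} {FX : DifferentialStructure X}
    {FY : DifferentialStructure Y} {φ : X → Y} (hφ : IsSmoothMap FX FY φ) (r : Setoid Y) :
    IsSmoothMap FX (FY.quotient r) (Quotient.mk r ∘ φ) :=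
  fun _ hf => hφ _ hf

theorem isSmoothMap_quotient_of_comp_submersion {P : SmoothMfd.{w}} {M : SmoothMfd.{u}}
    {Y : Type*} {FY : DifferentialStructure Y} {r : Setoid M} {a : P → M} {φ : Quotient r → Y}
    (hsurj : Function.Surjective a) (ha : Manifold.IsSubmersion P.model M.model ∞ a)
    (hφ : IsSmoothMap P.smoothFunctions FY (φ ∘ Quotient.mk r ∘ a)) :
    IsSmoothMap (M.smoothFunctions.quotient r) FY φ :=
  fun f hf => contMDiff_of_comp_submersion hsurj ha (hφ f hf)

end DifferentialStructure

theorem IsDiffeoBetween.surjOn {E E' H H' M N : Type*}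
    [NormedAddCommGroup E] [NormedSpace ℝ E] [NormedAddCommGroup E'] [NormedSpace ℝ E']
    [TopologicalSpace H] [TopologicalSpace H'] {I : ModelWithCorners ℝ E H}
    {J : ModelWithCorners ℝ E' H'} [TopologicalSpace M] [ChartedSpace H M]
    [TopologicalSpace N] [ChartedSpace H' N] {f : M → N} {S : Set M} {T : Set N}
    (hf : IsDiffeoBetween I J f S T) : Set.SurjOn f S T := by
  obtain ⟨-, -, g, -, hg, hinv⟩ := hf
  exact hinv.2.surjOn hg

namespace LieGroupoid

variable {G : LieGroupoid.{u, v}}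

theorem proj_eq_proj_iff {x y : G.Obj} :
    G.proj x = G.proj y ↔ ∃ g : G.Arr, G.src g = x ∧ G.tgt g = y :=
  Quotient.eq

theorem proj_src_eq_proj_tgt (g : G.Arr) : G.proj (G.src g) = G.proj (G.tgt g) :=
  proj_eq_proj_iff.2 ⟨g, rfl, rfl⟩

theorem surjective_proj : Function.Surjective G.proj :=
  Quotient.mk_surjective

theorem isSmoothMap_of_span {H : LieGroupoid.{u', v'}} {P : SmoothMfd.{w}} {a : P → G.Obj}
    {b : P → H.Obj} {φ : G.OrbitSpace → H.OrbitSpace} (hsurj : Function.Surjective a)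
    (ha : Manifold.IsSubmersion P.model G.Obj.model ∞ a)
    (hb : ContMDiff P.model H.Obj.model ∞ b)
    (h : ∀ p, φ (G.proj (a p)) = H.proj (b p)) :
    IsSmoothMap G.orbitStructure H.orbitStructure φ := by
  have hcomp : φ ∘ G.proj ∘ a = H.proj ∘ b := funext h
  have hsmooth : IsSmoothMap P.smoothFunctions H.orbitStructure (φ ∘ G.proj ∘ a) :=
    hcomp ▸ (isSmoothMap_of_contMDiff hb).quotientMk_comp H.orbitRel
  exact isSmoothMap_quotient_of_comp_submersion hsurj ha hsmooth

end LieGroupoid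

theorem LeftAction.proj_anchor_act {G : LieGroupoid.{u, v}} {P : SmoothMfd.{w}}
    (A : LeftAction G P) {g : G.Arr} {p : P} (hgp : G.src g = A.anchor p) :
    G.proj (A.anchor (A.act g p)) = G.proj (A.anchor p) := by
  rw [A.anchor_act g p hgp, ← hgp, G.proj_src_eq_proj_tgt]

theorem RightAction.proj_anchor_act {H : LieGroupoid.{u', v'}} {P : SmoothMfd.{w}}
    (A : RightAction H P) {p : P} {h : H.Arr} (hph : A.anchor p = H.tgt h) :
    H.proj (A.anchor (A.act p h)) = H.proj (A.anchor p) := by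
  rw [A.anchor_act p h hph, hph, H.proj_src_eq_proj_tgt]

theorem LeftAction.IsPrincipal.exists_act_eq {G : LieGroupoid.{u, v}} {P : SmoothMfd.{w}}
    {A : LeftAction G P} {B : SmoothMfd.{x}} {π : P → B} (hπ : A.IsPrincipal π) {p q : P}
    (hpq : π p = π q) : ∃ g : G.Arr, G.src g = A.anchor p ∧ A.act g p = q := by
  obtain ⟨⟨g, p'⟩, hdom, heq⟩ := hπ.diffeo.surjOn (a := (q, p)) hpq.symm
  obtain ⟨hact, rfl⟩ := Prod.mk.inj heq
  exact ⟨g, hdom, hact⟩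

theorem RightAction.IsPrincipal.exists_act_eq {H : LieGroupoid.{u', v'}} {P : SmoothMfd.{w}}
    {A : RightAction H P} {B : SmoothMfd.{x}} {π : P → B} (hπ : A.IsPrincipal π) {p q : P}
    (hpq : π p = π q) : ∃ h : H.Arr, A.anchor p = H.tgt h ∧ A.act p h = q := by
  obtain ⟨⟨p', h⟩, hdom, heq⟩ := hπ.diffeo.surjOn (a := (p, q)) hpq
  obtain ⟨rfl, hact⟩ := Prod.mk.inj heq
  exact ⟨h, hdom, hact⟩

namespace Bibundle

variable {G : LieGroupoid.{u, v}} {H : LieGroupoid.{u', v'}} {P : Bibundle.{u, v, u', v', w} G H}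
  {φ ψ : G.OrbitSpace → H.OrbitSpace}

theorem surjective_proj_left_anchor (P : Bibundle.{u, v, u', v', w} G H) :
    Function.Surjective (G.proj ∘ P.left.anchor) :=
  G.surjective_proj.comp P.principal.surjective

theorem factorsThrough_proj_left_anchor (P : Bibundle.{u, v, u', v', w} G H) :
    Function.FactorsThrough (H.proj ∘ P.right.anchor) (G.proj ∘ P.left.anchor) := by
  intro p q hpq
  obtain ⟨g, hgp, hgq⟩ := LieGroupoid.proj_eq_proj_iff.1 hpq
  have hfibre : P.left.anchor (P.left.act g p) = P.left.anchor q := by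
    rw [P.left.anchor_act g p hgp, hgq]
  obtain ⟨h, hh, rfl⟩ := P.principal.exists_act_eq hfibre
  calc H.proj (P.right.anchor p)
      = H.proj (P.right.anchor (P.left.act g p)) := by rw [P.invariant g p hgp]
    _ = H.proj (P.right.anchor (P.right.act (P.left.act g p) h)) :=
      (P.right.proj_anchor_act hh).symm

theorem IsInvertible.factorsThrough_proj_right_anchor (hP : P.IsInvertible) :
    Function.FactorsThrough (G.proj ∘ P.left.anchor) (H.proj ∘ P.right.anchor) := by
  intro p q hpq
  obtain ⟨h, hhq, hhp⟩ := LieGroupoid.proj_eq_proj_iff.1 hpq.symm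
  have hfibre : P.right.anchor (P.right.act p h) = P.right.anchor q := by
    rw [P.right.anchor_act p h hhp.symm, hhq]
  obtain ⟨g, hg, rfl⟩ := hP.exists_act_eq hfibre
  calc G.proj (P.left.anchor p)
      = G.proj (P.left.anchor (P.right.act p h)) := by rw [P.principal.invariant p h hhp.symm]
    _ = G.proj (P.left.anchor (P.left.act g (P.right.act p h))) :=
      (P.left.proj_anchor_act hg).symm

theorem exists_descendsTo (P : Bibundle.{u, v, u', v', w} G H) :
    ∃ φ : G.OrbitSpace → H.OrbitSpace, P.DescendsTo φ :=
  ⟨H.proj ∘ P.right.anchor ∘ Function.surjInv P.surjective_proj_left_anchor, fun _ =>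
    P.factorsThrough_proj_left_anchor (Function.surjInv_eq P.surjective_proj_left_anchor _)⟩

theorem DescendsTo.unique (hφ : P.DescendsTo φ) (hψ : P.DescendsTo ψ) : φ = ψ :=
  P.surjective_proj_left_anchor.injective_comp_right <| funext fun p => (hφ p).trans (hψ p).symm

theorem DescendsTo.isSmoothMap (hφ : P.DescendsTo φ) :
    IsSmoothMap G.orbitStructure H.orbitStructure φ :=
  LieGroupoid.isSmoothMap_of_span P.principal.surjective P.principal.submersion
    P.right.smooth_anchor hφ

theorem DescendsTo.bijective (hφ : P.DescendsTo φ) (hP : P.IsInvertible) :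
    Function.Bijective φ := by
  constructor
  · intro y z hyz
    obtain ⟨p, rfl⟩ := P.surjective_proj_left_anchor y
    obtain ⟨q, rfl⟩ := P.surjective_proj_left_anchor z
    exact hP.factorsThrough_proj_right_anchor ((hφ p).symm.trans (hyz.trans (hφ q)))
  · intro z
    obtain ⟨p, rfl⟩ := (H.surjective_proj.comp hP.surjective) z
    exact ⟨G.proj (P.left.anchor p), hφ p⟩

theorem DescendsTo.isDiffeomorphism (hφ : P.DescendsTo φ) (hP : P.IsInvertible) :
    IsDiffeomorphism G.orbitStructure H.orbitStructure φ := by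
  let e := Equiv.ofBijective φ (hφ.bijective hP)
  have hsymm : ∀ p, e.symm (H.proj (P.right.anchor p)) = G.proj (P.left.anchor p) :=
    fun p => e.symm_apply_eq.2 (hφ p).symm
  exact ⟨e, rfl, hφ.isSmoothMap, LieGroupoid.isSmoothMap_of_span hP.surjective hP.submersion
    P.left.smooth_anchor hsymm⟩

theorem Iso.descendsTo {Q : Bibundle.{u, v, u', v', w'} G H} (α : P.Iso Q)
    (hφ : Q.DescendsTo φ) : P.DescendsTo φ := by
  intro p
  rw [← α.left_anchor, ← α.right_anchor]
  exact hφ _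

end Bibundle

end OrbitMap

theorem lemmal_general (G : OrbitMap.LieGroupoid.{u, v}) (H : OrbitMap.LieGroupoid.{u', v'})
    (P : OrbitMap.Bibundle.{u, v, u', v', w} G H) :
    ∃ Pbar : G.OrbitSpace → H.OrbitSpace,
      (OrbitMap.IsSmoothMap G.orbitStructure H.orbitStructure Pbar ∧ P.DescendsTo Pbar ∧
        ∀ φ : G.OrbitSpace → H.OrbitSpace, P.DescendsTo φ → φ = Pbar) ∧
      (P.IsInvertible →
        OrbitMap.IsDiffeomorphism G.orbitStructure H.orbitStructure Pbar) ∧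
      ∀ Q : OrbitMap.Bibundle.{u, v, u', v', w'} G H, Nonempty (P.Iso Q) →
        ∀ Qbar : G.OrbitSpace → H.OrbitSpace, Q.DescendsTo Qbar → Qbar = Pbar := by
  obtain ⟨Pbar, hPbar⟩ := P.exists_descendsTo
  exact ⟨Pbar, ⟨hPbar.isSmoothMap, hPbar, fun φ hφ => hφ.unique hPbar⟩,
    fun hP => hPbar.isDiffeomorphism hP,
    fun Q ⟨α⟩ Qbar hQbar => (α.descendsTo hQbar).unique hPbar⟩

theorem lemmal (G : OrbitMap.LieGroupoid.{u, v}) (H : OrbitMap.LieGroupoid.{u', v'})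
    (hG : G.IsEffectiveProperEtale) (hH : H.IsEffectiveProperEtale)
    (P : OrbitMap.Bibundle.{u, v, u', v', w} G H) :
    ∃ Pbar : G.OrbitSpace → H.OrbitSpace,
      (OrbitMap.IsSmoothMap G.orbitStructure H.orbitStructure Pbar ∧ P.DescendsTo Pbar ∧
        ∀ φ : G.OrbitSpace → H.OrbitSpace, P.DescendsTo φ → φ = Pbar) ∧
      (P.IsInvertible →
        OrbitMap.IsDiffeomorphism G.orbitStructure H.orbitStructure Pbar) ∧
      ∀ Q : OrbitMap.Bibundle.{u, v, u', v', w'} G H, Nonempty (P.Iso Q) →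
        ∀ Qbar : G.OrbitSpace → H.OrbitSpace, Q.DescendsTo Qbar → Qbar = Pbar :=
  lemmal_general G H P
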